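/- Let $Z$ be a real random variable with a non-extremal stable law of index $0<\alpha<2$; that is, for some $a\in\mathbb{R}$, $c_*>0$ and $-1<\beta<1$, $$\mathbf{E}\,e^{itZ}=\exp\big\{iat-c_*|t|^\alpha\big(1+i\beta\,\mathrm{sign}(t)\,\omega(t,\alpha)\big)\big\}\qquad(t\in\mathbb{R}),$$ where $\omega(t,\alpha)=\tan(\pi\alpha/2)$ if $\alpha\neq1$ and $\omega(t,1)=\frac{2}{\pi}\log|t|$ (the exponent being read as $0$ at $t=0$). Let $\psi$ be the smooth positive density of $Z$. For a real random variable $X$ with an absolutely continuous density $p$ and Radon–Nikodym derivative $p'$, put $$I(X)=\int_{\{p>0\}}\frac{p'(x)^2}{p(x)}\,dx,\qquad I(X\|Z)=\int_{\{p>0\}}\Big(\frac{p'(x)}{p(x)}-\frac{\psi'(x)}{\psi(x)}\Big)^2p(x)\,dx,$$ and put $I(X)=I(X\|Z)=+\infty$ for every other random variable $X$. Then there is a finite constant $c(Z)\geq 0$, depending only on the distribution of $Z$, such that for every real random variable $X$ $$I(X\|Z)\le 2\,I(X)+c(Z)\qquad\text{and}\qquad I(X)\le 2\,I(X\|Z)+c(Z).$$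 In particular, $I(X\|Z)<+\infty$ if and only if $I(X)<+\infty$. -/

import Mathlib

open MeasureTheory
open scoped ENNReal NNReal

noncomputable section

/-- The function `ω(t, α)`: it is `tan (π α / 2)` if `α ≠ 1`, and `(2 / π) log |t|` if `α = 1`. -/
def stableOmega (t α : ℝ) : ℝ :=
  if α = 1 then 2 / Real.pi * Real.log |t| else Real.tan (Real.pi * α / 2)

/-- `μ` is the stable law on the line with parameters `α`, `β`, `a`, `c`: it is a probability
measure whose characteristic function `f(t) = ∫ e^{itx} dμ(x)` is
`exp (i a t - c |t|^α (1 + i β sign(t) ω(t, α)))`. -/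
def IsStableLaw (α β a c : ℝ) (μ : Measure ℝ) : Prop :=
  IsProbabilityMeasure μ ∧ ∀ t : ℝ, charFun μ t =
    Complex.exp (Complex.I * a * t
      - c * ((|t| ^ α : ℝ) : ℂ) * (1 + Complex.I * β * (Real.sign t : ℂ) * (stableOmega t α : ℂ)))

/-- `μ` is a (non-degenerate) non-extremal stable law of index `α`, where `0 < α ≤ 2`: the skewness
`β` satisfies `-1 < β < 1`. For `α = 2` we have `ω = tan π = 0`, and the condition says that `μ` is
a normal law. -/
def IsNonextremalStable (α : ℝ) (μ : Measure ℝ) : Prop :=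
  0 < α ∧ α ≤ 2 ∧ ∃ β a c : ℝ, -1 < β ∧ β < 1 ∧ 0 < c ∧ IsStableLaw α β a c μ

/-- `p` is a density of `μ` with respect to Lebesgue measure that is absolutely continuous
(on every compact interval). -/
def IsACDensity (μ : Measure ℝ) (p : ℝ → ℝ) : Prop :=
  (∀ x, 0 ≤ p x) ∧ (∀ a b : ℝ, AbsolutelyContinuousOnInterval p a b) ∧
    μ = volume.withDensity (fun x => ENNReal.ofReal (p x))

/-- The Fisher information `I(X)` of a random variable `X` with law `μ`. It is `∫ p'(x)² / p(x) dx`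
if `μ` has an absolutely continuous density `p` (then `p` is unique, and the points with `p x = 0`
contribute `0`), and `∞` otherwise, as an infimum over the empty set. The ordinary derivative of `p`
exists almost everywhere and is its Radon-Nikodym derivative. -/
def fisherInfo (μ : Measure ℝ) : ℝ≥0∞ :=
  ⨅ (p : ℝ → ℝ) (_ : IsACDensity μ p), ∫⁻ x, ENNReal.ofReal ((deriv p x) ^ 2 / p x)

/-- The Fisher information distance `I(X||Z)` of a random variable `X` with law `μ` to a random
variable `Z` with law `ν`. It is `∫ (p'(x) / p(x) - ψ'(x) / ψ(x))² p(x) dx` if `μ` has an absolutely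
continuous density `p` (`ψ` being the density of `ν`), and `∞` otherwise. -/
def fisherDist (μ ν : Measure ℝ) : ℝ≥0∞ :=
  ⨅ (p : ℝ → ℝ) (_ : IsACDensity μ p) (ψ : ℝ → ℝ) (_ : IsACDensity ν ψ),
    ∫⁻ x, ENNReal.ofReal ((deriv p x / p x - deriv ψ x / ψ x) ^ 2 * p x)

theorem IsACDensity.continuous {μ : Measure ℝ} {p : ℝ → ℝ} (hp : IsACDensity μ p) :
    Continuous p := by
  rw [continuous_iff_continuousAt]
  intro x
  refine (hp.2.1 (x - 1) (x + 1)).continuousOn.continuousAt ?_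
  rw [Set.uIcc_of_le (by linarith)]
  exact Icc_mem_nhds (by linarith) (by linarith)

/-- The absolutely continuous density is unique. -/
theorem IsACDensity.unique {μ : Measure ℝ} {p q : ℝ → ℝ} [IsFiniteMeasure μ]
    (hp : IsACDensity μ p) (hq : IsACDensity μ q) : p = q := by
  have h1 : (fun x => ENNReal.ofReal (p x)) =ᵐ[volume] fun x => ENNReal.ofReal (q x) := by
    refine (withDensity_eq_iff hp.continuous.measurable.ennreal_ofReal.aemeasurable
      hq.continuous.measurable.ennreal_ofReal.aemeasurable ?_).1 (hp.2.2.symm.trans hq.2.2)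
    have := measure_ne_top μ Set.univ
    rw [hp.2.2] at this
    simpa using this
  refine Continuous.ae_eq_iff_eq volume hp.continuous hq.continuous |>.1 ?_
  filter_upwards [h1] with x hx
  exact (ENNReal.ofReal_eq_ofReal_iff (hp.1 x) (hq.1 x)).1 hx

theorem fisherInfo_eq {μ : Measure ℝ} [IsFiniteMeasure μ] {p : ℝ → ℝ} (hp : IsACDensity μ p) :
    fisherInfo μ = ∫⁻ x, ENNReal.ofReal ((deriv p x) ^ 2 / p x) :=
  le_antisymm (iInf₂_le p hp) (le_iInf₂ fun q hq => by rw [hp.unique hq])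

theorem fisherDist_eq {μ ν : Measure ℝ} [IsFiniteMeasure μ] [IsFiniteMeasure ν] {p ψ : ℝ → ℝ}
    (hp : IsACDensity μ p) (hψ : IsACDensity ν ψ) :
    fisherDist μ ν =
      ∫⁻ x, ENNReal.ofReal ((deriv p x / p x - deriv ψ x / ψ x) ^ 2 * p x) :=
  le_antisymm ((iInf₂_le p hp).trans (iInf₂_le ψ hψ))
    (le_iInf₂ fun q hq => le_iInf₂ fun φ hφ => by rw [hp.unique hq, hψ.unique hφ])

end

/-! ### Integrals of rational type that produce the stable exponent. -/

section RationalIntegrals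

open Set Filter Topology Real

/-! Everything reduces to a bound `|ψ'| ≤ C ψ` for the stable density. With `u = p'/p` and `v =
ψ'/ψ`, the inequalities `(u - v)² ≤ 2u² + 2v²` and `u² ≤ 2(u - v)² + 2v²`, integrated against `p`,
then give both claims with constant `2C²`.

The bound comes from a factorization: the stable law is the convolution of a Laplace law and some
probability law (`IsStableLaw.exists_eq_laplaceMeasure_conv`). The Laplace density obeys `ℓ(y) ≤
e^{a|y-x|} ℓ(x)`, a property that survives averaging over translates, so the logarithm of the
convolved density is Lipschitz (`exists_isACDensity_laplaceMeasure_conv`).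

For the factorization, compare Lévy densities at `x > 0`. The stable one is a multiple of
`x^{-1-α}`, a mixture of the `e^{-sx}` with weight `k s^α`; the Laplace one is `e^{-ax}/x = ∫_a^∞
e^{-sx} ds`, with weight `1_{s>a}`. The residual weight `k s^α - 1_{s>a}` is nonnegative once `a` is
large, provided `k > 0`; the same is needed on the negative half-line, and non-extremality makes
both coefficients positive. Truncating `s` to compact intervals yields compound Poisson laws with
exponential jumps (`isCharFun_residual`). Their characteristic functions, with suitable drifts,
converge to the stable one divided by the Laplace one, which is therefore a characteristic function
(`IsCharFun.of_tendsto`). -/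

lemma sin_pi_mul_half_pos {b : ℝ} (hb0 : 0 < b) (hb2 : b < 2) : 0 < sin (π * b / 2) :=
  sin_pos_of_pos_of_lt_pi (by positivity) (by nlinarith [pi_pos])

/-- Write `1/(s² + t²) = ∫_0^∞ e^{-(s²+t²)y} dy` and apply Tonelli: both remaining integrals are
Gamma integrals, and the reflection formula gives the sine. -/
lemma lintegral_rpow_div_sq_add_sq {b t : ℝ} (hb0 : 0 < b) (hb2 : b < 2) (ht : 0 < t) :
    ∫⁻ s in Ioi (0 : ℝ), ENNReal.ofReal (s ^ (b - 1) / (s ^ 2 + t ^ 2))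
      = ENNReal.ofReal (t ^ (b - 2) * (π / 2 / sin (π * b / 2))) := by
  have hinner : ∀ s ∈ Ioi (0 : ℝ), ENNReal.ofReal (s ^ (b - 1) / (s ^ 2 + t ^ 2))
      = ∫⁻ y in Ioi (0 : ℝ), ENNReal.ofReal (s ^ (b - 1) * exp (-(s ^ 2 + t ^ 2) * y)) := by
    intro s hs
    have hs : 0 < s := hs
    have hpos : 0 < s ^ 2 + t ^ 2 := by positivity
    rw [← ofReal_integral_eq_lintegral_ofReal
      ((integrableOn_exp_mul_Ioi (neg_lt_zero.2 hpos) 0).const_mul _)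
      (ae_of_all _ fun y => by positivity), integral_const_mul,
      integral_exp_mul_Ioi (neg_lt_zero.2 hpos)]
    congr 1
    simp only [mul_zero, exp_zero]
    field_simp
  have houter : ∀ y ∈ Ioi (0 : ℝ),
      ∫⁻ s in Ioi (0 : ℝ), ENNReal.ofReal (s ^ (b - 1) * exp (-(s ^ 2 + t ^ 2) * y))
      = ENNReal.ofReal (Gamma (b / 2) / 2 * (y ^ ((1 - b / 2) - 1) * exp (-(t ^ 2 * y)))) := by
    intro y hy
    have hy : 0 < y := hy
    have key : ∀ s : ℝ, s ^ (b - 1) * exp (-(s ^ 2 + t ^ 2) * y)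
        = exp (-(t ^ 2 * y)) * (s ^ (b - 1) * exp (-y * s ^ (2 : ℝ))) := by
      intro s
      rw [rpow_two, mul_left_comm, ← exp_add]
      ring_nf
    simp_rw [key]
    rw [← ofReal_integral_eq_lintegral_ofReal
      ((integrableOn_rpow_mul_exp_neg_mul_rpow (by linarith) two_pos hy).const_mul _)
      ((ae_restrict_mem measurableSet_Ioi).mono fun s (hs : 0 < s) => by positivity),
      integral_const_mul, integral_rpow_mul_exp_neg_mul_rpow two_pos (by linarith) hy]
    congr 1
    rw [show (1 - b / 2) - 1 = -(b - 1 + 1) / 2 by ring, show (b - 1 + 1) / 2 = b / 2 by ring]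
    ring
  have hsin := sin_pi_mul_half_pos hb0 hb2
  have hG : Gamma (b / 2) * Gamma (1 - b / 2) = π / sin (π * b / 2) := by
    rw [Gamma_mul_Gamma_one_sub, mul_div_assoc]
  rw [setLIntegral_congr_fun measurableSet_Ioi hinner, lintegral_lintegral_swap,
    setLIntegral_congr_fun measurableSet_Ioi houter, ← ofReal_integral_eq_lintegral_ofReal,
    integral_const_mul, integral_rpow_mul_exp_neg_mul_Ioi (by linarith) (by positivity)]
  · congr 1
    have : (1 / t ^ 2) ^ (1 - b / 2) = t ^ (b - 2) := by
      rw [one_div, inv_rpow (by positivity), ← rpow_neg (by positivity), ← rpow_two,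
        ← rpow_mul ht.le]
      ring_nf
    rw [this]
    linear_combination (t ^ (b - 2) / 2) * hG
  · have := integrableOn_rpow_mul_exp_neg_mul_rpow (p := 1) (s := 1 - b / 2 - 1) (b := t ^ 2)
      (by linarith) one_pos (by positivity)
    simp_rw [rpow_one, neg_mul] at this
    exact this.const_mul _
  · refine (ae_restrict_mem measurableSet_Ioi).mono fun y (hy : 0 < y) => ?_
    have := Gamma_pos_of_pos (half_pos hb0)
    positivity
  · fun_prop

lemma integrableOn_rpow_div_sq_add_sq {b t : ℝ} (hb0 : 0 < b) (hb2 : b < 2) (ht : 0 < t) :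
    IntegrableOn (fun s : ℝ => s ^ (b - 1) / (s ^ 2 + t ^ 2)) (Ioi 0) := by
  refine (lintegral_ofReal_ne_top_iff_integrable
    (by fun_prop : Measurable fun s : ℝ => s ^ (b - 1) / (s ^ 2 + t ^ 2)).aestronglyMeasurable ?_).1 ?_
  · exact (ae_restrict_mem measurableSet_Ioi).mono fun s (hs : 0 < s) => by positivity
  · rw [lintegral_rpow_div_sq_add_sq hb0 hb2 ht]
    exact ENNReal.ofReal_ne_top

lemma integral_rpow_div_sq_add_sq {b t : ℝ} (hb0 : 0 < b) (hb2 : b < 2) (ht : 0 < t) :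
    ∫ s in Ioi (0 : ℝ), s ^ (b - 1) / (s ^ 2 + t ^ 2)
      = t ^ (b - 2) * (π / 2 / sin (π * b / 2)) := by
  have := sin_pi_mul_half_pos hb0 hb2
  rw [integral_eq_lintegral_of_nonneg_ae, lintegral_rpow_div_sq_add_sq hb0 hb2 ht,
    ENNReal.toReal_ofReal (by positivity)]
  · exact (ae_restrict_mem measurableSet_Ioi).mono fun s (hs : 0 < s) => by positivity
  · exact (by fun_prop :
      Measurable fun s : ℝ => s ^ (b - 1) / (s ^ 2 + t ^ 2)).aestronglyMeasurable

lemma hasDerivAt_log_sq_add_sq {s t : ℝ} (h : s ^ 2 + t ^ 2 ≠ 0) :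
    HasDerivAt (fun x : ℝ => log (x ^ 2 + t ^ 2)) (2 * s / (s ^ 2 + t ^ 2)) s := by
  have := (((hasDerivAt_id s).pow 2).add_const (t ^ 2)).log h
  simpa using this

lemma tendsto_log_sq_add_sq_sub (t u : ℝ) :
    Tendsto (fun s : ℝ => log (s ^ 2 + t ^ 2) - log (s ^ 2 + u ^ 2)) atTop (𝓝 0) := by
  have hq : Tendsto (fun s : ℝ => s ^ 2) atTop atTop := tendsto_pow_atTop two_ne_zero
  have h0 : ∀ r : ℝ, Tendsto (fun s : ℝ => log (1 + r ^ 2 / s ^ 2)) atTop (𝓝 0) := by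
    intro r
    have : Tendsto (fun s : ℝ => 1 + r ^ 2 / s ^ 2) atTop (𝓝 (1 + 0)) :=
      tendsto_const_nhds.add (hq.const_div_atTop _)
    simpa using this.log (by simp)
  have := (h0 t).sub (h0 u)
  rw [sub_zero] at this
  refine this.congr' ?_
  filter_upwards [eventually_gt_atTop 0] with s hs
  have h1 : ∀ r : ℝ, log (s ^ 2 + r ^ 2) = log (s ^ 2) + log (1 + r ^ 2 / s ^ 2) := by
    intro r
    rw [← log_mul (by positivity) (by positivity)]
    congr 1
    field_simp
  rw [h1 t, h1 u]
  ring

/-- This is the Laplace exponent in mixture form: the value is minus the logarithm of the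
characteristic function of the Laplace law with rate `a`. -/
lemma integrableOn_and_integral_log_one_add_sq {a : ℝ} (ha : 0 < a) (t : ℝ) :
    IntegrableOn (fun s : ℝ => 2 * t ^ 2 / (s * (s ^ 2 + t ^ 2))) (Ioi a) ∧
      ∫ s in Ioi a, 2 * t ^ 2 / (s * (s ^ 2 + t ^ 2)) = log (1 + t ^ 2 / a ^ 2) := by
  have hd : ∀ s ∈ Ici a, HasDerivAt
      (fun x : ℝ => -(log (x ^ 2 + t ^ 2) - log (x ^ 2 + 0 ^ 2)))
      (2 * t ^ 2 / (s * (s ^ 2 + t ^ 2))) s := by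
    intro s hs
    have hs : 0 < s := lt_of_lt_of_le ha hs
    refine ((hasDerivAt_log_sq_add_sq (s := s) (t := t) (by positivity)).sub
      (hasDerivAt_log_sq_add_sq (s := s) (t := 0) (by positivity))).neg.congr_deriv ?_
    field_simp
    ring
  have hlim := (tendsto_log_sq_add_sq_sub t 0).neg
  have hnn : ∀ s ∈ Ioi a, 0 ≤ 2 * t ^ 2 / (s * (s ^ 2 + t ^ 2)) := by
    intro s hs
    have hs : 0 < s := ha.trans hs
    positivity
  refine ⟨integrableOn_Ioi_deriv_of_nonneg' hd hnn hlim, ?_⟩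
  rw [integral_Ioi_of_hasDerivAt_of_nonneg' hd hnn hlim, neg_zero, zero_sub, neg_neg,
    ← log_div (by positivity) (by positivity)]
  congr 1
  field_simp
  ring

lemma integrableOn_and_integral_log {t : ℝ} (ht : 0 < t) :
    IntegrableOn (fun s : ℝ => s * t / (s ^ 2 + t ^ 2) - t * (s / (s ^ 2 + 1))) (Ioi 0) ∧
      ∫ s in Ioi (0 : ℝ), (s * t / (s ^ 2 + t ^ 2) - t * (s / (s ^ 2 + 1))) = -(t * log t) := by
  have hd : ∀ s ∈ Ici (0 : ℝ), HasDerivAt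
      (fun x : ℝ => t / 2 * (log (x ^ 2 + t ^ 2) - log (x ^ 2 + 1 ^ 2)))
      (s * t / (s ^ 2 + t ^ 2) - t * (s / (s ^ 2 + 1))) s := by
    intro s hs
    refine (((hasDerivAt_log_sq_add_sq (s := s) (t := t) (by positivity)).sub
      (hasDerivAt_log_sq_add_sq (s := s) (t := 1) (by positivity))).const_mul
        (t / 2)).congr_deriv ?_
    field_simp
  have hlim := (tendsto_log_sq_add_sq_sub t 1).const_mul (t / 2)
  -- The factor `1 - t²` fixes the sign of the integrand on the half-line, so integrability follows
  -- from convergence of the primitive.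
  have heq : ∀ s : ℝ, s * t / (s ^ 2 + t ^ 2) - t * (s / (s ^ 2 + 1))
      = t * s / ((s ^ 2 + t ^ 2) * (s ^ 2 + 1)) * (1 - t ^ 2) := by
    intro s
    field_simp
    ring
  have hint : IntegrableOn (fun s : ℝ => s * t / (s ^ 2 + t ^ 2) - t * (s / (s ^ 2 + 1)))
      (Ioi 0) := by
    rcases le_total t 1 with h1 | h1
    · refine integrableOn_Ioi_deriv_of_nonneg' hd (fun s hs => ?_) hlim
      have hs : 0 < s := hs
      rw [heq]
      exact mul_nonneg (by positivity) (by nlinarith)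
    · refine integrableOn_Ioi_deriv_of_nonpos' hd (fun s hs => ?_) hlim
      have hs : 0 < s := hs
      rw [heq]
      exact mul_nonpos_of_nonneg_of_nonpos (by positivity) (by nlinarith)
  refine ⟨hint, ?_⟩
  rw [integral_Ioi_of_hasDerivAt_of_tendsto' hd hint hlim]
  have : log (t ^ 2) = 2 * log t := by rw [log_pow]; norm_num
  simp [this]
  ring

/-- With a suitable compensator, the imaginary part of the exponent of a stable law is an integral
over a mixture of exponential laws. -/
lemma exists_stable_compensator {α : ℝ} (hα0 : 0 < α) (hα2 : α < 2) :
    ∃ (g : ℝ → ℝ) (σ : ℝ), ContinuousOn g (Ioi 0) ∧ (σ = 1 ∨ σ = -1) ∧ ∀ t : ℝ, 0 < t →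
      IntegrableOn (fun s : ℝ => s ^ α * t / (s ^ 2 + t ^ 2) - t * g s) (Ioi 0) ∧
      ∫ s in Ioi (0 : ℝ), (s ^ α * t / (s ^ 2 + t ^ 2) - t * g s)
        = σ * (π / 2 / sin (π * α / 2)) * t ^ α * stableOmega t α := by
  -- At infinity the integrand behaves like `t s^{α-2}`, integrable only for `α < 1`. For `α > 1`
  -- this tail itself is subtracted; for `α = 1` it would be singular at `0`, hence `s/(s² + 1)`,
  -- and the value `-t log t` forces `σ = -1`.
  rcases lt_trichotomy α 1 with h | h | h
  · refine ⟨fun _ => 0, 1, continuousOn_const, Or.inl rfl, fun t ht => ?_⟩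
    have e : (fun s : ℝ => s ^ α * t / (s ^ 2 + t ^ 2) - t * 0)
        = fun s : ℝ => t * (s ^ ((α + 1) - 1) / (s ^ 2 + t ^ 2)) := by
      ext s
      rw [add_sub_cancel_right]
      ring
    rw [e]
    refine ⟨(integrableOn_rpow_div_sq_add_sq (by linarith) (by linarith) ht).const_mul _, ?_⟩
    have hc : 0 < cos (π * α / 2) := cos_pos_of_mem_Ioo ⟨by nlinarith [pi_pos], by nlinarith [pi_pos]⟩
    have hs := sin_pi_mul_half_pos hα0 hα2
    rw [integral_const_mul, integral_rpow_div_sq_add_sq (by linarith) (by linarith) ht,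
      show π * (α + 1) / 2 = π * α / 2 + π / 2 by ring, sin_add_pi_div_two, stableOmega,
      if_neg h.ne, tan_eq_sin_div_cos, show α + 1 - 2 = α - 1 by ring, rpow_sub_one ht.ne']
    field_simp
  · subst h
    refine ⟨fun s => s / (s ^ 2 + 1), -1,
      (continuous_id.div (by fun_prop) fun s => by positivity).continuousOn, Or.inr rfl,
      fun t ht => ?_⟩
    simp_rw [rpow_one]
    refine ⟨(integrableOn_and_integral_log ht).1, ?_⟩
    rw [(integrableOn_and_integral_log ht).2, stableOmega, if_pos rfl, mul_one, sin_pi_div_two,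
      abs_of_pos ht]
    field_simp
  · refine ⟨fun s => s ^ (α - 2), 1, ?_, Or.inl rfl, fun t ht => ?_⟩
    · exact fun s (hs : 0 < s) => (continuousAt_rpow_const _ _ (Or.inl hs.ne')).continuousWithinAt
    have e : EqOn (fun s : ℝ => s ^ α * t / (s ^ 2 + t ^ 2) - t * s ^ (α - 2))
        (fun s : ℝ => -t ^ 3 * (s ^ ((α - 1) - 1) / (s ^ 2 + t ^ 2))) (Ioi 0) := by
      intro s hs
      have hs : 0 < s := hs
      have : s ^ α = s ^ (α - 2) * s ^ 2 := by
        rw [← rpow_two, ← rpow_add hs]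
        ring_nf
      simp only [this, show (α - 1) - 1 = α - 2 by ring]
      field_simp
      ring
    rw [setIntegral_congr_fun measurableSet_Ioi e, integrableOn_congr_fun e measurableSet_Ioi]
    refine ⟨(integrableOn_rpow_div_sq_add_sq (by linarith) (by linarith) ht).const_mul _, ?_⟩
    have hc : cos (π * α / 2) < 0 :=
      cos_neg_of_pi_div_two_lt_of_lt (by nlinarith [pi_pos]) (by nlinarith [pi_pos])
    have hs := sin_pi_mul_half_pos hα0 hα2
    have ht3 : t ^ (α - 1 - 2) * t ^ 3 = t ^ α := by
      rw [← rpow_natCast t 3, ← rpow_add ht]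
      push_cast
      ring_nf
    rw [integral_const_mul, integral_rpow_div_sq_add_sq (by linarith) (by linarith) ht,
      show π * (α - 1) / 2 = π * α / 2 - π / 2 by ring, sin_sub_pi_div_two, stableOmega,
      if_neg h.ne', tan_eq_sin_div_cos, ← ht3]
    have h1 := hc.ne
    have h2 := hs.ne'
    generalize cos (π * α / 2) = x at *
    generalize sin (π * α / 2) = y at *
    field_simp

end RationalIntegrals

/-! ### Characteristic functions: limits, mixtures, compound Poisson laws. -/

section CharacteristicFunctions

open Set Filter Topology Complex BoundedContinuousFunction

/-- `f` is the characteristic function of a probability law on the line. -/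
def IsCharFun (f : ℝ → ℂ) : Prop :=
  ∃ μ : Measure ℝ, IsProbabilityMeasure μ ∧ ∀ t, charFun μ t = f t

lemma IsCharFun.mul {f g : ℝ → ℂ} (hf : IsCharFun f) (hg : IsCharFun g) :
    IsCharFun fun t => f t * g t := by
  obtain ⟨μ, _, hμ⟩ := hf
  obtain ⟨ν, _, hν⟩ := hg
  exact ⟨μ ∗ ν, inferInstance, fun t => by rw [charFun_conv, hμ, hν]⟩

lemma isCharFun_exp_mul_I (x : ℝ) : IsCharFun fun t => exp (x * t * I) :=
  ⟨Measure.dirac x, inferInstance, fun t => by simp [charFun_dirac, mul_comm]⟩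

lemma IsCharFun.pow {f : ℝ → ℂ} (hf : IsCharFun f) (n : ℕ) : IsCharFun fun t => f t ^ n := by
  induction n with
  | zero => simpa using isCharFun_exp_mul_I 0
  | succ n ih => simpa only [pow_succ] using ih.mul hf

/-- A pointwise limit of characteristic functions on the positive half-line is a characteristic
function, if it extends to a Hermitian function that is continuous at the origin. -/
lemma IsCharFun.of_tendsto {F : ℕ → ℝ → ℂ} {f : ℝ → ℂ} (hF : ∀ n, IsCharFun (F n))
    (h0 : f 0 = 1) (hcont : ContinuousAt f 0) (hneg : ∀ t, f (-t) = starRingEnd ℂ (f t))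
    (hlim : ∀ t, 0 < t → Tendsto (fun n => F n t) atTop (𝓝 (f t))) : IsCharFun f := by
  choose μ hμ hμF using hF
  have hlim' : ∀ t, Tendsto (fun n => charFun (μ n) t) atTop (𝓝 (f t)) := by
    intro t
    rcases lt_trichotomy t 0 with ht | rfl | ht
    · have h1 := (hlim (-t) (neg_pos.2 ht)).star
      rw [hneg] at h1
      simp only [← hμF, charFun_neg, RCLike.star_def, Complex.conj_conj] at h1
      exact h1
    · simp [h0]
    · simpa only [hμF] using hlim t ht
  -- Continuity of the limit at `0` prevents mass from escaping; a weak cluster point `Q` then has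
  -- characteristic function `f`.
  have htight := isTightMeasureSet_of_tendsto_charFun hcont hlim'
  let P : ℕ → ProbabilityMeasure ℝ := fun n => ⟨μ n, hμ n⟩
  have hcomp : IsCompact (closure (range P)) := by
    refine isCompact_closure_of_isTightMeasureSet ?_
    convert htight using 1
    ext m
    constructor
    · rintro ⟨_, ⟨n, rfl⟩, rfl⟩
      exact ⟨n, rfl⟩
    · rintro ⟨n, rfl⟩
      exact ⟨P n, ⟨n, rfl⟩, rfl⟩
  obtain ⟨Q, -, hQ⟩ := hcomp.exists_mapClusterPt (u := P) (f := atTop)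
    (by simp only [le_principal_iff, mem_map]
        exact univ_mem' fun n => subset_closure (mem_range_self n))
  refine ⟨Q, inferInstance, fun t => ?_⟩
  obtain ⟨U, hU, hUQ⟩ := mapClusterPt_iff_ultrafilter.1 hQ
  rw [ProbabilityMeasure.tendsto_iff_forall_integral_rclike_tendsto ℂ] at hUQ
  have h1 := hUQ (innerProbChar t)
  simp_rw [← charFun_eq_integral_innerProbChar] at h1
  exact tendsto_nhds_unique h1 ((hlim' t).mono_left hU)

/-- A mixture of rescalings of a law, of total mass at most `1`, completed by an atom at `0`. -/
lemma IsCharFun.mixture {S : Type*} [MeasurableSpace S] {f : ℝ → ℂ} (hf : IsCharFun f)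
    (m : Measure S) (hm : m univ ≤ 1) {g : S → ℝ} (hg : Measurable g) :
    IsCharFun fun t => 1 + ∫ s, (f (t * g s) - 1) ∂m := by
  obtain ⟨P, _, hP⟩ := hf
  have : IsFiniteMeasure m := ⟨hm.trans_lt ENNReal.one_lt_top⟩
  let M : Measure ℝ := (m.prod P).map fun z => g z.1 * z.2
  have hmeas : Measurable fun z : S × ℝ => g z.1 * z.2 := by fun_prop
  have hM : M univ = m univ := by
    rw [Measure.map_apply hmeas MeasurableSet.univ, preimage_univ, ← univ_prod_univ, Measure.prod_prod]
    simp
  have : IsFiniteMeasure M := by infer_instance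
  have hfm : Measurable f := by
    rw [← funext hP]
    exact measurable_charFun
  have hfi : ∀ t, Integrable (fun s => f (t * g s)) m := fun t =>
    Integrable.of_bound (hfm.comp (hg.const_mul t)).aestronglyMeasurable 1
      (ae_of_all _ fun s => by rw [← hP]; exact norm_charFun_le_one _)
  refine ⟨M + (1 - m univ) • Measure.dirac 0, ⟨?_⟩, fun t => ?_⟩
  · simp [hM, add_tsub_cancel_of_le hm]
  have hd : (∫ x, exp (t * x * I) ∂((1 - m univ) • Measure.dirac (0 : ℝ)))
      = 1 - m.real univ := by
    rw [integral_smul_measure, integral_dirac]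
    simp [ENNReal.toReal_sub_of_le hm, Measure.real]
  rw [charFun_apply_real, integral_add_measure, hd]
  · rw [integral_map hmeas.aemeasurable (by fun_prop), integral_prod]
    · have : ∀ s, ∫ y, exp (t * (g s * y : ℝ) * I) ∂P = f (t * g s) := by
        intro s
        rw [← hP, charFun_apply_real]
        push_cast
        simp_rw [mul_assoc]
      simp only [this]
      rw [integral_sub (hfi t) (integrable_const _)]
      simp
      ring
    · refine Integrable.of_bound (by fun_prop) 1 (ae_of_all _ fun z => ?_)
      rw [← ofReal_mul, norm_exp_ofReal_mul_I]
  · refine Integrable.of_bound (by fun_prop) 1 (ae_of_all _ fun z => ?_)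
    rw [← ofReal_mul, norm_exp_ofReal_mul_I]
  · refine Integrable.smul_measure ?_ (by simp)
    exact integrable_dirac (by simp)

/-- The characteristic function of a compound Poisson law whose jumps are mixtures of rescalings of
a given law. -/
lemma IsCharFun.compoundPoisson {S : Type*} [MeasurableSpace S] {f : ℝ → ℂ} (hf : IsCharFun f)
    (m : Measure S) [IsFiniteMeasure m] {g : S → ℝ} (hg : Measurable g) :
    IsCharFun fun t => exp (∫ s, (f (t * g s) - 1) ∂m) := by
  obtain ⟨P, _, hP⟩ := id hf
  have hfc : Continuous f := by
    rw [← funext hP]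
    exact continuous_charFun
  have hf0 : f 0 = 1 := by simp [← hP]
  obtain ⟨N, hN⟩ := exists_nat_ge (m univ).toReal
  -- The shift makes `k n` positive and at least the mass of `m`, so `m / k n` is an admissible
  -- mixing measure; the exponential is the limit of `(1 + z / k)^k`.
  let k : ℕ → ℕ := fun n => n + (N + 1)
  have hF : ∀ n, IsCharFun fun t => (1 + (∫ s, (f (t * g s) - 1) ∂m) / (k n : ℕ)) ^ (k n) := by
    intro n
    have hle : ((k n : ℝ≥0∞)⁻¹ • m) univ ≤ 1 := by
      rw [Measure.smul_apply, smul_eq_mul, mul_comm, ← div_eq_mul_inv]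
      refine ENNReal.div_le_of_le_mul ?_
      rw [one_mul, ← ENNReal.ofReal_toReal (measure_ne_top m univ), ← ENNReal.ofReal_natCast]
      refine ENNReal.ofReal_le_ofReal (hN.trans ?_)
      simp only [k]
      push_cast
      linarith [(Nat.cast_nonneg n : (0 : ℝ) ≤ n)]
    have := (hf.mixture ((k n : ℝ≥0∞)⁻¹ • m) hle hg).pow (k n)
    simp_rw [integral_smul_measure] at this
    convert this using 5
    simp [div_eq_inv_mul]
  refine IsCharFun.of_tendsto hF (by simp [hf0]) ?_ ?_ ?_
  · refine (continuous_exp.comp (continuous_of_dominated (bound := fun _ => 2) ?_ ?_ ?_ ?_)).continuousAt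
    · exact fun t => ((hfc.measurable.comp (hg.const_mul t)).sub_const 1).aestronglyMeasurable
    · refine fun t => ae_of_all _ fun s => ?_
      rw [← hP, norm_sub_rev]
      exact norm_one_sub_charFun_le_two
    · exact integrable_const _
    · exact ae_of_all _ fun s => by fun_prop
  · intro t
    rw [← exp_conj, ← integral_conj]
    simp_rw [map_sub, map_one, neg_mul, ← hP, charFun_neg]
  · intro t _
    exact (tendsto_one_add_div_pow_exp _).comp (tendsto_add_atTop_nat (N + 1))

lemma isCharFun_exponential : IsCharFun fun t => 1 / (1 - t * I) := by
  have hint : IntegrableOn (fun x : ℝ => Real.exp (-x)) (Ioi 0) := integrableOn_exp_neg_Ioi 0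
  refine ⟨(volume.restrict (Ioi 0)).withDensity fun x => ENNReal.ofReal (Real.exp (-x)), ⟨?_⟩,
    fun t => ?_⟩
  · rw [withDensity_apply _ MeasurableSet.univ, Measure.restrict_univ,
      ← ofReal_integral_eq_lintegral_ofReal hint (ae_of_all _ fun x => (Real.exp_pos _).le),
      integral_exp_neg_Ioi_zero, ENNReal.ofReal_one]
  · rw [charFun_apply_real, integral_withDensity_eq_integral_toReal_smul (by fun_prop) (by simp)]
    have : ∀ x : ℝ, (ENNReal.ofReal (Real.exp (-x))).toReal • exp (t * x * I)
        = exp ((t * I - 1) * x) := by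
      intro x
      rw [ENNReal.toReal_ofReal (Real.exp_pos _).le, real_smul, ofReal_exp, ← exp_add]
      push_cast
      ring_nf
    simp_rw [this]
    have hne : (t * I - 1 : ℂ) ≠ 0 := fun h => by simpa using congrArg re h
    rw [integral_exp_mul_complex_Ioi (by simp)]
    have hne' : (1 - t * I : ℂ) ≠ 0 := fun h => hne (by linear_combination -h)
    simp only [ofReal_zero, mul_zero, exp_zero]
    field_simp
    ring

end CharacteristicFunctions

/-! ### Laplace laws and the log-Lipschitz property of their convolutions. -/

section Laplace

open Set Filter Topology

/-- The density of the Laplace law with rate `a`. -/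
noncomputable def laplaceDensity (a x : ℝ) : ℝ := a / 2 * Real.exp (-(a * |x|))

lemma continuous_laplaceDensity (a : ℝ) : Continuous (laplaceDensity a) := by
  unfold laplaceDensity
  fun_prop

lemma laplaceDensity_nonneg {a : ℝ} (ha : 0 < a) (x : ℝ) : 0 ≤ laplaceDensity a x := by
  unfold laplaceDensity
  positivity

lemma laplaceDensity_le {a : ℝ} (ha : 0 < a) (x : ℝ) : laplaceDensity a x ≤ a / 2 := by
  unfold laplaceDensity
  have : Real.exp (-(a * |x|)) ≤ 1 := Real.exp_le_one_iff.2 (by simp; positivity)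
  nlinarith

/-- A Harnack-type bound, linear in the density and hence inherited by all mixtures of translates.
-/
lemma laplaceDensity_le_exp_mul {a : ℝ} (ha : 0 < a) (x y : ℝ) :
    laplaceDensity a y ≤ Real.exp (a * |y - x|) * laplaceDensity a x := by
  unfold laplaceDensity
  rw [mul_left_comm, ← Real.exp_add]
  gcongr
  have := abs_sub_abs_le_abs_sub x y
  rw [abs_sub_comm] at this
  nlinarith

/-- The Laplace law with rate `a`. -/
noncomputable def laplaceMeasure (a : ℝ) : Measure ℝ :=
  volume.withDensity fun x => ENNReal.ofReal (laplaceDensity a x)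

lemma charFun_laplaceMeasure {a : ℝ} (ha : 0 < a) (t : ℝ) :
    charFun (laplaceMeasure a) t = ((1 + t ^ 2 / a ^ 2 : ℝ) : ℂ)⁻¹ := by
  have hre1 : (t * Complex.I - a : ℂ).re < 0 := by simpa
  have hre2 : 0 < (t * Complex.I + a : ℂ).re := by simpa
  have h1 : EqOn (fun x : ℝ => (ENNReal.ofReal (laplaceDensity a x)).toReal •
      Complex.exp (t * x * Complex.I))
      (fun x => (a / 2 : ℂ) * Complex.exp ((t * Complex.I - a) * x)) (Ioi 0) := by
    intro x (hx : 0 < x)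
    simp only
    rw [ENNReal.toReal_ofReal (laplaceDensity_nonneg ha x), laplaceDensity, abs_of_pos hx,
      Complex.real_smul]
    push_cast
    rw [mul_assoc, ← Complex.exp_add]
    ring_nf
  have h2 : EqOn (fun x : ℝ => (ENNReal.ofReal (laplaceDensity a x)).toReal •
      Complex.exp (t * x * Complex.I))
      (fun x => (a / 2 : ℂ) * Complex.exp ((t * Complex.I + a) * x)) (Iic 0) := by
    intro x (hx : x ≤ 0)
    simp only
    rw [ENNReal.toReal_ofReal (laplaceDensity_nonneg ha x), laplaceDensity, abs_of_nonpos hx,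
      Complex.real_smul]
    push_cast
    rw [mul_assoc, ← Complex.exp_add]
    ring_nf
  have i1 := (integrableOn_exp_mul_complex_Ioi hre1 0).const_mul (a / 2 : ℂ)
  have i2 := (integrableOn_exp_mul_complex_Iic hre2 0).const_mul (a / 2 : ℂ)
  rw [charFun_apply_real, laplaceMeasure, integral_withDensity_eq_integral_toReal_smul
    (by have := continuous_laplaceDensity a; fun_prop) (by simp),
    ← intervalIntegral.integral_Iic_add_Ioi (b := 0)
      ((integrableOn_congr_fun h2 measurableSet_Iic).2 i2)
      ((integrableOn_congr_fun h1 measurableSet_Ioi).2 i1),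
    setIntegral_congr_fun measurableSet_Iic h2, setIntegral_congr_fun measurableSet_Ioi h1,
    integral_const_mul, integral_const_mul, integral_exp_mul_complex_Ioi hre1,
    integral_exp_mul_complex_Iic hre2]
  have e1 : (t * Complex.I - a : ℂ) ≠ 0 := fun h => by simp [h] at hre1
  have e2 : (t * Complex.I + a : ℂ) ≠ 0 := fun h => by simp [h] at hre2
  have e3 : (a : ℂ) ≠ 0 := by exact_mod_cast ha.ne'
  have e4 : ((1 + t ^ 2 / a ^ 2 : ℝ) : ℂ)
      = -((t * Complex.I - a) * (t * Complex.I + a)) / a ^ 2 := by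
    push_cast
    field_simp
    linear_combination (t : ℂ) ^ 2 * Complex.I_sq
  rw [e4]
  simp only [Complex.ofReal_zero, mul_zero, Complex.exp_zero]
  field_simp
  ring

lemma isProbabilityMeasure_laplaceMeasure {a : ℝ} (ha : 0 < a) :
    IsProbabilityMeasure (laplaceMeasure a) := by
  have h := charFun_laplaceMeasure ha 0
  rw [charFun_zero] at h
  have h1 : (laplaceMeasure a).real univ = 1 := by
    have : (((laplaceMeasure a).real univ : ℝ) : ℂ) = (1 : ℝ) := by simpa using h
    exact_mod_cast this
  refine ⟨?_⟩
  rw [Measure.real, ENNReal.toReal_eq_one_iff] at h1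
  exact h1

/-- The convolution of a Laplace law with a probability law has a density whose logarithm is
Lipschitz. -/
lemma exists_isACDensity_laplaceMeasure_conv {a : ℝ} (ha : 0 < a) (μ : Measure ℝ)
    [IsProbabilityMeasure μ] :
    ∃ ψ : ℝ → ℝ, IsACDensity (laplaceMeasure a ∗ μ) ψ ∧
      ∃ C : ℝ, 0 ≤ C ∧ ∀ x, |deriv ψ x| ≤ C * ψ x := by
  have hc := continuous_laplaceDensity a
  have hint : ∀ x, Integrable (fun y => laplaceDensity a (x - y)) μ := fun x =>
    Integrable.of_bound (by fun_prop) (a / 2) (ae_of_all _ fun y => by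
      rw [Real.norm_of_nonneg (laplaceDensity_nonneg ha _)]
      exact laplaceDensity_le ha _)
  let ψ : ℝ → ℝ := fun x => ∫ y, laplaceDensity a (x - y) ∂μ
  have hψ0 : ∀ x, 0 ≤ ψ x := fun x => integral_nonneg fun y => laplaceDensity_nonneg ha _
  have hψb : ∀ x, ψ x ≤ a / 2 := fun x => by
    have := integral_mono (hint x) (integrable_const (a / 2)) fun y => laplaceDensity_le ha (x - y)
    simpa using this
  have hexp : ∀ x y, ψ y ≤ Real.exp (a * |y - x|) * ψ x := by
    intro x y
    rw [← integral_const_mul]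
    refine integral_mono (hint y) ((hint x).const_mul _) fun z => ?_
    have := laplaceDensity_le_exp_mul ha (x - z) (y - z)
    rwa [sub_sub_sub_cancel_right] at this
  have hdiff : ∀ x y, |ψ y - ψ x| ≤ (Real.exp (a * |y - x|) - 1) * ψ x := by
    intro x y
    set E := Real.exp (a * |y - x|) with hE
    have hE1 : 1 ≤ E := Real.one_le_exp (by positivity)
    have h1 := hexp x y
    have h2 := hexp y x
    rw [abs_sub_comm x y, ← hE] at h2
    rw [← hE] at h1
    rw [abs_le]
    refine ⟨?_, by linarith⟩
    have h3 := hψ0 y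
    by_contra! hlt
    nlinarith
  -- From `e^r - 1 ≤ r e^r` with `r = a|y - x| ≤ a`. Keeping the factor `ψ x` is what later bounds
  -- `ψ'/ψ`.
  have hlip : ∀ x y, |y - x| ≤ 1 → |ψ y - ψ x| ≤ a * Real.exp a * ψ x * |y - x| := by
    intro x y hxy
    refine (hdiff x y).trans ?_
    have h1 : Real.exp (a * |y - x|) - 1 ≤ a * |y - x| * Real.exp (a * |y - x|) := by
      have := Real.add_one_le_exp (-(a * |y - x|))
      have h2 : Real.exp (-(a * |y - x|)) * Real.exp (a * |y - x|) = 1 := by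
        rw [← Real.exp_add]; simp
      nlinarith [Real.exp_pos (a * |y - x|)]
    have h2 : Real.exp (a * |y - x|) ≤ Real.exp a :=
      Real.exp_le_exp.2 (by nlinarith [abs_nonneg (y - x)])
    have h3 : Real.exp (a * |y - x|) - 1 ≤ a * |y - x| * Real.exp a :=
      h1.trans (by gcongr)
    calc _ ≤ a * |y - x| * Real.exp a * ψ x := by gcongr; exact hψ0 x
      _ = _ := by ring
  -- A global Lipschitz bound, needed only for absolute continuity; far apart points use `0 ≤ ψ ≤ a
  -- / 2`.
  have hLip : ∀ x y, |ψ y - ψ x| ≤ a * Real.exp a * (a / 2) * |y - x| + a * |y - x| := by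
    intro x y
    rcases le_total |y - x| 1 with h | h
    · refine (hlip x y h).trans ?_
      have := hψb x
      have h0 : 0 ≤ a * |y - x| := by positivity
      have : a * Real.exp a * ψ x * |y - x| ≤ a * Real.exp a * (a / 2) * |y - x| := by gcongr
      linarith
    · have h1 : |ψ y - ψ x| ≤ a := by
        rw [abs_le]
        constructor <;> linarith [hψb x, hψb y, hψ0 x, hψ0 y]
      have : 0 ≤ a * Real.exp a * (a / 2) * |y - x| := by positivity
      nlinarith
  have hK : LipschitzWith (a * Real.exp a * (a / 2) + a).toNNReal ψ := LipschitzWith.of_dist_le_mul fun x y => by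
    have := hLip y x
    rw [Real.dist_eq, Real.dist_eq, Real.coe_toNNReal _ (by positivity)]
    exact this.trans_eq (by ring)
  refine ⟨ψ, ⟨hψ0, fun u v => hK.lipschitzOnWith.absolutelyContinuousOnInterval, ?_⟩,
    a * Real.exp a, by positivity, fun x => ?_⟩
  · have := isProbabilityMeasure_laplaceMeasure ha
    refine Measure.ext_of_lintegral _ fun h hh => ?_
    rw [Measure.conv_comm, Measure.lintegral_conv hh,
      lintegral_withDensity_eq_lintegral_mul _ hK.continuous.measurable.ennreal_ofReal hh]
    have h1 : ∀ y, ∫⁻ x, h (y + x) ∂(laplaceMeasure a)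
        = ∫⁻ x, ENNReal.ofReal (laplaceDensity a (x - y)) * h x := by
      intro y
      rw [laplaceMeasure, lintegral_withDensity_eq_lintegral_mul _ (by fun_prop) (by fun_prop),
        ← lintegral_add_right_eq_self
          (fun x => ENNReal.ofReal (laplaceDensity a (x - y)) * h x) y]
      simp [add_comm]
    simp_rw [h1]
    rw [lintegral_lintegral_swap (by fun_prop)]
    refine lintegral_congr fun x => ?_
    rw [lintegral_mul_const _ (by fun_prop), Pi.mul_apply, ofReal_integral_eq_lintegral_ofReal
      (hint x) (ae_of_all _ fun y => laplaceDensity_nonneg ha _)]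
  · have hx := hψ0 x
    rw [← Real.norm_eq_abs]
    refine norm_deriv_le_of_lip' (by positivity) ?_
    filter_upwards [Metric.ball_mem_nhds x one_pos] with y hy
    exact hlip x y (le_of_lt hy)

end Laplace

/-! ### Splitting a Laplace factor off a stable law. -/

section StableFactorization

open Set Filter Topology Complex

/-- The difference between a multiple of the exponential mixing density of a one-sided stable Lévy
measure and that of a Laplace law. -/
noncomputable def residualWeight (α a k s : ℝ) : ℝ := k * s ^ α - (Ioi a).indicator 1 s

lemma measurable_residualWeight (α a k : ℝ) : Measurable (residualWeight α a k) := by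
  unfold residualWeight
  exact (by fun_prop : Measurable fun s : ℝ => k * s ^ α).sub
    (measurable_one.indicator measurableSet_Ioi)

lemma residualWeight_nonneg {α a k : ℝ} (hk : 0 < k) (ha : ∀ s, a < s → 1 ≤ k * s ^ α)
    {s : ℝ} (hs : 0 < s) : 0 ≤ residualWeight α a k s := by
  unfold residualWeight
  by_cases h : s ∈ Ioi a
  · simpa [h] using ha s h
  · rw [indicator_of_notMem h, sub_zero]
    positivity

lemma integrableOn_residualWeight_div {α a k u v : ℝ} (hu : 0 < u) :
    IntegrableOn (fun s => residualWeight α a k s / s) (Icc u v) := by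
  have h1 : IntegrableOn (fun s : ℝ => k * s ^ α / s) (Icc u v) := by
    refine ContinuousOn.integrableOn_Icc fun s hs => ?_
    have hs : 0 < s := hu.trans_le hs.1
    exact ((continuousAt_const.mul (Real.continuousAt_rpow_const _ _ (Or.inl hs.ne'))).div
      continuousAt_id hs.ne').continuousWithinAt
  have h2 : IntegrableOn (fun s : ℝ => s⁻¹) (Icc u v) := by
    refine ContinuousOn.integrableOn_Icc fun s hs => ?_
    exact (continuousAt_inv₀ (hu.trans_le hs.1).ne').continuousWithinAt
  refine (h1.sub (h2.indicator (measurableSet_Ioi (a := a)))).congr (ae_of_all _ fun s => ?_)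
  by_cases h : s ∈ Ioi a
  · simp only [Pi.sub_apply, residualWeight, indicator_of_mem h, Pi.one_apply]
    ring
  · simp only [Pi.sub_apply, residualWeight, indicator_of_notMem h]
    ring

/-- Characteristic functions of compound Poisson laws with jumps that are mixtures of one-sided exponential laws. -/
lemma isCharFun_residual {α a k u v ε : ℝ} (hk : 0 < k) (ha : ∀ s, a < s → 1 ≤ k * s ^ α)
    (hu : 0 < u) :
    IsCharFun fun t => exp (∫ s in Icc u v,
      ((residualWeight α a k s / s : ℝ) : ℂ) * (1 / (1 - (t * (ε * s⁻¹) : ℝ) * I) - 1)) := by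
  have hint := integrableOn_residualWeight_div (α := α) (a := a) (k := k) (v := v) hu
  have := isFiniteMeasure_withDensity_ofReal hint.2
  have hm : Measurable fun s => residualWeight α a k s / s :=
    (measurable_residualWeight α a k).div measurable_id
  convert isCharFun_exponential.compoundPoisson
    ((volume.restrict (Icc u v)).withDensity fun s => ENNReal.ofReal (residualWeight α a k s / s))
    (g := fun s => ε * s⁻¹) (by fun_prop) using 3 with t
  rw [integral_withDensity_eq_integral_toReal_smul hm.ennreal_ofReal (by simp)]
  refine setIntegral_congr_fun measurableSet_Icc fun s hs => ?_
  have hs : 0 < s := hu.trans_le hs.1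
  rw [ENNReal.toReal_ofReal (div_nonneg (residualWeight_nonneg hk ha hs) hs.le), real_smul]

lemma integrableOn_residual {α a k u v ε : ℝ} (hu : 0 < u) (t : ℝ) :
    IntegrableOn (fun s => ((residualWeight α a k s / s : ℝ) : ℂ) *
      (1 / (1 - (t * (ε * s⁻¹) : ℝ) * I) - 1)) (Icc u v) := by
  obtain ⟨P, _, hP⟩ := isCharFun_exponential
  have hP : ∀ t, charFun P t = 1 / (1 - t * I) := hP
  refine (integrableOn_residualWeight_div hu).ofReal.mul_bdd (c := 2) ?_ ?_
  · exact (by fun_prop : Measurable fun s : ℝ =>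
      (1 / (1 - (t * (ε * s⁻¹) : ℝ) * I) - 1)).aestronglyMeasurable
  · refine ae_of_all _ fun s => ?_
    rw [← hP, norm_sub_rev]
    exact norm_one_sub_charFun_le_two

/-- The algebraic identity behind the factorization of a stable characteristic function. -/
lemma residual_add_residual {α a k l s t : ℝ} (hs : 0 < s) :
    ((residualWeight α a k s / s : ℝ) : ℂ) * (1 / (1 - (t * (1 * s⁻¹) : ℝ) * I) - 1)
      + ((residualWeight α a l s / s : ℝ) : ℂ) * (1 / (1 - (t * (-1 * s⁻¹) : ℝ) * I) - 1)
    = ((-(k + l) * (t ^ 2 * (s ^ (α - 1) / (s ^ 2 + t ^ 2)))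
        + (Ioi a).indicator (fun s => 2 * t ^ 2 / (s * (s ^ 2 + t ^ 2))) s : ℝ) : ℂ)
      + (((k - l) * (s ^ α * t / (s ^ 2 + t ^ 2)) : ℝ) : ℂ) * I := by
  have hs' : (s : ℂ) ≠ 0 := by exact_mod_cast hs.ne'
  have hp : (s - t * I : ℂ) ≠ 0 := fun h => hs.ne' (by simpa using congrArg re h)
  have hm : (s + t * I : ℂ) ≠ 0 := fun h => hs.ne' (by simpa using congrArg re h)
  have hq : (s ^ 2 + t ^ 2 : ℂ) = (s - t * I) * (s + t * I) := by
    linear_combination (t : ℂ) ^ 2 * I_sq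
  have e1 : 1 / (1 - (t * (1 * s⁻¹) : ℝ) * I) - 1 = t * I / (s - t * I) := by
    have : (1 - (t * (1 * s⁻¹) : ℝ) * I) = (s - t * I) / s := by
      push_cast
      field_simp
    rw [this]
    field_simp
    ring
  have e2 : 1 / (1 - (t * (-1 * s⁻¹) : ℝ) * I) - 1 = -(t * I) / (s + t * I) := by
    have : (1 - (t * (-1 * s⁻¹) : ℝ) * I) = (s + t * I) / s := by
      push_cast
      field_simp
      ring
    rw [this]
    field_simp
    ring
  have hr : s ^ (α - 1) = s ^ α / s := Real.rpow_sub_one hs.ne' _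
  have hind : (Ioi a).indicator (fun s : ℝ => 2 * t ^ 2 / (s * (s ^ 2 + t ^ 2))) s
      = (Ioi a).indicator 1 s * (2 * t ^ 2 / (s * (s ^ 2 + t ^ 2))) := by
    by_cases h : s ∈ Ioi a <;> simp [h]
  -- The indicator survives only in the real part: the Laplace law is symmetric, so its imaginary
  -- contributions cancel.
  rw [e1, e2, hind, hr]
  simp only [residualWeight]
  generalize (Ioi a).indicator (1 : ℝ → ℝ) s = d
  generalize s ^ α = r
  push_cast
  rw [hq]
  field_simp
  ring_nf
  simp only [I_sq]
  ring

/-- A non-extremal stable law is the convolution of a Laplace law with a probability law. -/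
theorem IsStableLaw.exists_eq_laplaceMeasure_conv {α β b c : ℝ} {ν : Measure ℝ} (hα0 : 0 < α)
    (hα2 : α < 2) (hβ : -1 < β) (hβ' : β < 1) (hc : 0 < c) (hν : IsStableLaw α β b c ν) :
    ∃ (a : ℝ) (μ : Measure ℝ), 0 < a ∧ IsProbabilityMeasure μ ∧ ν = laplaceMeasure a ∗ μ := by
  obtain ⟨_, hνφ⟩ := hν
  obtain ⟨g, σ, hg, hσ, hgint⟩ := exists_stable_compensator hα0 hα2
  have hsin := sin_pi_mul_half_pos hα0 hα2
  set A : ℝ := Real.pi / 2 / Real.sin (Real.pi * α / 2) with hA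
  have hA0 : 0 < A := by positivity
  -- `k` and `l` solve `(k + l) A = c` and `(k - l) σ A = -cβ`, which match the real and imaginary
  -- parts of the stable exponent. Both are positive exactly because `|β| < 1`.
  set k : ℝ := c * (1 - σ * β) / (2 * A) with hk
  set l : ℝ := c * (1 + σ * β) / (2 * A) with hl
  have hσβ : 0 < 1 - σ * β ∧ 0 < 1 + σ * β := by
    rcases hσ with rfl | rfl <;> constructor <;> linarith
  have hk0 : 0 < k := by have := hσβ.1; positivity
  have hl0 : 0 < l := by have := hσβ.2; positivity
  have hkl : (k + l) * A = c := by rw [hk, hl]; field_simp; ring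
  have hkl' : (k - l) * σ * A = -(c * β) := by
    have : σ ^ 2 = 1 := by rcases hσ with rfl | rfl <;> norm_num
    rw [hk, hl]
    field_simp
    linear_combination (-2 * β) * this
  obtain ⟨a, ha, hak, hal⟩ : ∃ a : ℝ, 0 < a ∧ (∀ s, a < s → 1 ≤ k * s ^ α) ∧
      ∀ s, a < s → 1 ≤ l * s ^ α := by
    have h1 := ((tendsto_rpow_atTop hα0).const_mul_atTop hk0).eventually_ge_atTop 1
    have h2 := ((tendsto_rpow_atTop hα0).const_mul_atTop hl0).eventually_ge_atTop 1
    obtain ⟨a, h⟩ := eventually_atTop.1 (h1.and h2)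
    exact ⟨max a 1, by positivity, fun s hs => (h s ((le_max_left _ _).trans hs.le)).1,
      fun s hs => (h s ((le_max_left _ _).trans hs.le)).2⟩
  let u : ℕ → ℝ := fun n => ((n : ℝ) + 1)⁻¹
  let v : ℕ → ℝ := fun n => (n : ℝ) + 1
  have hu : ∀ n, 0 < u n := fun n => by positivity
  have hv : Monotone v := fun n m hnm => by
    have : (n : ℝ) ≤ m := by exact_mod_cast hnm
    change (n : ℝ) + 1 ≤ (m : ℝ) + 1
    linarith
  -- `R` is the real part of the combined residual exponent; `J` is its imaginary part after
  -- compensation.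
  let R : ℝ → ℝ → ℝ := fun t s => -(k + l) * (t ^ 2 * (s ^ (α - 1) / (s ^ 2 + t ^ 2)))
    + (Ioi a).indicator (fun s => 2 * t ^ 2 / (s * (s ^ 2 + t ^ 2))) s
  let J : ℝ → ℝ → ℝ := fun t s => (k - l) * (s ^ α * t / (s ^ 2 + t ^ 2) - t * g s)
  have hRint : ∀ t, 0 < t → IntegrableOn (R t) (Ioi 0) := fun t ht =>
    (((integrableOn_rpow_div_sq_add_sq hα0 hα2 ht).const_mul _).const_mul _).add
      ((integrable_indicator_iff measurableSet_Ioi).2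
        (((integrableOn_and_integral_log_one_add_sq ha t).1).mono_measure
          Measure.restrict_le_self))
  have hJint : ∀ t, 0 < t → IntegrableOn (J t) (Ioi 0) := fun t ht =>
    (hgint t ht).1.const_mul _
  have hRval : ∀ t, 0 < t → ∫ s in Ioi (0 : ℝ), R t s
      = -(c * t ^ α) + Real.log (1 + t ^ 2 / a ^ 2) := by
    intro t ht
    rw [integral_add, integral_const_mul, integral_const_mul,
      integral_rpow_div_sq_add_sq hα0 hα2 ht, ← hA, setIntegral_indicator measurableSet_Ioi,
      inter_eq_right.2 (Ioi_subset_Ioi ha.le), (integrableOn_and_integral_log_one_add_sq ha t).2,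
      ← hkl]
    · have : t ^ α = t ^ 2 * t ^ (α - 2) := by
        rw [← Real.rpow_two, ← Real.rpow_add ht]
        ring_nf
      rw [this]
      ring
    · exact ((integrableOn_rpow_div_sq_add_sq hα0 hα2 ht).const_mul _).const_mul _
    · exact (integrable_indicator_iff measurableSet_Ioi).2
        (((integrableOn_and_integral_log_one_add_sq ha t).1).mono_measure
          Measure.restrict_le_self)
  have hJval : ∀ t, 0 < t → ∫ s in Ioi (0 : ℝ), J t s = -(c * β * t ^ α * stableOmega t α) := by
    intro t ht
    rw [integral_const_mul, (hgint t ht).2]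
    linear_combination (t ^ α * stableOmega t α) * hkl'
  -- The stable characteristic function divided by the Laplace one; it must be shown to be a
  -- characteristic function.
  let f : ℝ → ℂ := fun t => charFun ν t * ((1 + t ^ 2 / a ^ 2 : ℝ) : ℂ)
  -- Positive jumps, negative jumps, and a drift that carries the compensator truncated to the same
  -- interval.
  have hF : ∀ n, IsCharFun fun t =>
      exp (∫ s in Icc (u n) (v n), ((residualWeight α a k s / s : ℝ) : ℂ) *
        (1 / (1 - (t * (1 * s⁻¹) : ℝ) * I) - 1)) *
      exp (∫ s in Icc (u n) (v n), ((residualWeight α a l s / s : ℝ) : ℂ) *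
        (1 / (1 - (t * (-1 * s⁻¹) : ℝ) * I) - 1)) *
      exp ((b - (k - l) * ∫ s in Icc (u n) (v n), g s : ℝ) * t * I) := fun n =>
    ((isCharFun_residual hk0 hak (hu n)).mul (isCharFun_residual hl0 hal (hu n))).mul
      (isCharFun_exp_mul_I _)
  have hf : IsCharFun f := by
    refine IsCharFun.of_tendsto hF (by simp [f]) ?_ ?_ fun t ht => ?_
    · exact (continuous_charFun.mul (by fun_prop)).continuousAt
    · intro t
      simp only [f, charFun_neg, neg_sq, map_mul, conj_ofReal]
    have hR : Integrable (fun s => (R t s : ℂ)) (volume.restrict (Ioi 0)) := (hRint t ht).ofReal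
    have hJ : Integrable (fun s => (J t s : ℂ) * I) (volume.restrict (Ioi 0)) :=
      (hJint t ht).ofReal.mul_const I
    have hG : IntegrableOn (fun s => (R t s : ℂ) + (J t s : ℂ) * I) (Ioi 0) := hR.add hJ
    have hUn : ⋃ n, Icc (u n) (v n) = Ioi 0 := by
      ext s
      simp only [mem_iUnion, mem_Icc, mem_Ioi]
      refine ⟨fun ⟨n, h, _⟩ => (hu n).trans_le h, fun hs => ?_⟩
      obtain ⟨n, hn⟩ := exists_nat_ge (max s s⁻¹)
      have h1 : s ≤ n := (le_max_left _ _).trans hn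
      have h2 : s⁻¹ ≤ n := (le_max_right _ _).trans hn
      exact ⟨n, inv_le_of_inv_le₀ hs (show s⁻¹ ≤ (n : ℝ) + 1 by linarith),
        show s ≤ (n : ℝ) + 1 by linarith⟩
    have hlim := tendsto_setIntegral_of_monotone (μ := volume)
      (f := fun s => (R t s : ℂ) + (J t s : ℂ) * I) (s := fun n => Icc (u n) (v n))
      (fun n => measurableSet_Icc) (fun n m hnm => Icc_subset_Icc
        (inv_anti₀ (by positivity) (hv hnm)) (hv hnm)) (by rwa [hUn])
    rw [hUn] at hlim
    have hval : ∫ s in Ioi (0 : ℝ), ((R t s : ℂ) + (J t s : ℂ) * I)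
        = ((-(c * t ^ α) + Real.log (1 + t ^ 2 / a ^ 2) : ℝ) : ℂ)
          + ((-(c * β * t ^ α * stableOmega t α) : ℝ) : ℂ) * I := by
      rw [integral_add hR hJ, integral_mul_const, integral_complex_ofReal,
        integral_complex_ofReal, hRval t ht, hJval t ht]
    have hft : f t = exp ((∫ s in Ioi (0 : ℝ), ((R t s : ℂ) + (J t s : ℂ) * I)) + b * t * I) := by
      have hpos : 0 < 1 + t ^ 2 / a ^ 2 := by positivity
      rw [hval]
      simp only [f]
      rw [hνφ, ← Real.exp_log hpos, ofReal_exp, ← exp_add, Real.exp_log hpos, Real.sign_of_pos ht,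
        abs_of_pos ht]
      congr 1
      push_cast
      ring
    rw [hft]
    refine ((hlim.add_const (b * t * I)).cexp).congr fun n => ?_
    have hg' : IntegrableOn (fun s => ((-((k - l) * t) * g s : ℝ) : ℂ) * I) (Icc (u n) (v n)) :=
      (((hg.mono fun s hs => (hu n).trans_le hs.1).integrableOn_Icc.const_mul _).ofReal).mul_const I
    rw [← exp_add, ← exp_add, ← integral_add (integrableOn_residual (hu n) t)
      (integrableOn_residual (hu n) t)]
    congr 1
    have hsum : ∫ s in Icc (u n) (v n), ((R t s : ℂ) + (J t s : ℂ) * I)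
        = (∫ s in Icc (u n) (v n),
          (((residualWeight α a k s / s : ℝ) : ℂ) * (1 / (1 - (t * (1 * s⁻¹) : ℝ) * I) - 1)
          + ((residualWeight α a l s / s : ℝ) : ℂ) * (1 / (1 - (t * (-1 * s⁻¹) : ℝ) * I) - 1)))
          + ∫ s in Icc (u n) (v n), ((-((k - l) * t) * g s : ℝ) : ℂ) * I := by
      have hres : Integrable (fun s =>
          (((residualWeight α a k s / s : ℝ) : ℂ) * (1 / (1 - (t * (1 * s⁻¹) : ℝ) * I) - 1)
          + ((residualWeight α a l s / s : ℝ) : ℂ) * (1 / (1 - (t * (-1 * s⁻¹) : ℝ) * I) - 1)))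
          (volume.restrict (Icc (u n) (v n))) :=
        (integrableOn_residual (hu n) t).add (integrableOn_residual (hu n) t)
      rw [← integral_add hres hg']
      refine setIntegral_congr_fun measurableSet_Icc fun s hs => ?_
      rw [residual_add_residual ((hu n).trans_le hs.1)]
      simp only [R, J]
      push_cast
      ring
    rw [hsum, integral_mul_const, integral_complex_ofReal, integral_const_mul]
    push_cast
    ring
  obtain ⟨μ, hμ, hμf⟩ := hf
  have := isProbabilityMeasure_laplaceMeasure ha
  refine ⟨a, μ, ha, hμ, Measure.ext_of_charFun (funext fun t => ?_)⟩
  rw [charFun_conv, charFun_laplaceMeasure ha, hμf]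
  have hne : ((1 + t ^ 2 / a ^ 2 : ℝ) : ℂ) ≠ 0 := by
    have : (0 : ℝ) < 1 + t ^ 2 / a ^ 2 := by positivity
    exact_mod_cast this.ne'
  rw [mul_comm, mul_assoc, mul_inv_cancel₀ hne, mul_one]

/-- The logarithmic derivative of the density of a non-extremal stable law is bounded. -/
theorem IsNonextremalStable.exists_isACDensity {α : ℝ} (hα : α < 2) {ν : Measure ℝ}
    (hν : IsNonextremalStable α ν) :
    ∃ ψ : ℝ → ℝ, IsACDensity ν ψ ∧ ∃ C : ℝ, 0 ≤ C ∧ ∀ x, |deriv ψ x| ≤ C * ψ x := by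
  obtain ⟨hα0, -, β, b, c, hβ, hβ', hc, hs⟩ := hν
  obtain ⟨a, μ, ha, hμ, rfl⟩ := hs.exists_eq_laplaceMeasure_conv hα0 hα hβ hβ' hc
  exact exists_isACDensity_laplaceMeasure_conv ha μ

end StableFactorization

/-! ### Comparison of the two Fisher functionals. -/

section FisherInformation

/-- Only the summand with `p` has to be measurable for additivity, so `f` and `h` are arbitrary. -/
lemma lintegral_ofReal_le_two_mul_add {p f h : ℝ → ℝ} (hpm : Measurable p)
    (hp1 : ∫⁻ x, ENNReal.ofReal (p x) = 1) {K : ℝ≥0}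
    (hle : ∀ x, f x ≤ 2 * h x + K * p x) :
    ∫⁻ x, ENNReal.ofReal (f x) ≤ 2 * (∫⁻ x, ENNReal.ofReal (h x)) + K := by
  calc ∫⁻ x, ENNReal.ofReal (f x)
      ≤ ∫⁻ x, (2 * ENNReal.ofReal (h x) + K * ENNReal.ofReal (p x)) := by
        refine lintegral_mono fun x => (ENNReal.ofReal_le_ofReal (hle x)).trans ?_
        refine ENNReal.ofReal_add_le.trans (add_le_add ?_ ?_)
        · rw [ENNReal.ofReal_mul zero_le_two, ENNReal.ofReal_ofNat]
        · rw [ENNReal.ofReal_mul K.coe_nonneg, ENNReal.ofReal_coe_nnreal]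
    _ = 2 * (∫⁻ x, ENNReal.ofReal (h x)) + K := by
        rw [lintegral_add_right _ (hpm.ennreal_ofReal.const_mul _),
          lintegral_const_mul' _ _ ENNReal.ofNat_ne_top,
          lintegral_const_mul' _ _ ENNReal.coe_ne_top, hp1, mul_one]

end FisherInformation

/-- `ν` is the law of `Z`, and `μ` is the law of `X`; the constant depends only on `ν`. -/
theorem proposition2p2 (α : ℝ) (hα : α < 2) (ν : Measure ℝ) (hν : IsNonextremalStable α ν) :
    ∃ c : ℝ≥0, ∀ (μ : Measure ℝ), IsProbabilityMeasure μ →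
      fisherDist μ ν ≤ 2 * fisherInfo μ + c ∧
      fisherInfo μ ≤ 2 * fisherDist μ ν + c ∧
      (fisherDist μ ν < ∞ ↔ fisherInfo μ < ∞) := by
  obtain ⟨ψ, hψ, C, hC, hψC⟩ := hν.exists_isACDensity hα
  obtain ⟨-, -, β, b, c, -, -, -, hνP, -⟩ := hν
  -- Positivity of `ψ` is not needed: where `ψ x = 0` the quotient is `0` by convention.
  have hr : ∀ x, (deriv ψ x / ψ x) ^ 2 ≤ C ^ 2 := fun x => by
    rw [← sq_abs, abs_div, abs_of_nonneg (hψ.1 x)]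
    exact pow_le_pow_left₀ (div_nonneg (abs_nonneg _) (hψ.1 x))
      (div_le_of_le_mul₀ (hψ.1 x) hC (hψC x)) 2
  suffices H : ∀ μ : Measure ℝ, IsProbabilityMeasure μ →
      fisherDist μ ν ≤ 2 * fisherInfo μ + (2 * C ^ 2).toNNReal ∧
      fisherInfo μ ≤ 2 * fisherDist μ ν + (2 * C ^ 2).toNNReal by
    refine ⟨(2 * C ^ 2).toNNReal, fun μ hμ => ⟨(H μ hμ).1, (H μ hμ).2, fun h => ?_, fun h => ?_⟩⟩
    · exact (H μ hμ).2.trans_lt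
        (ENNReal.add_lt_top.2 ⟨ENNReal.mul_lt_top (by simp) h, ENNReal.coe_lt_top⟩)
    · exact (H μ hμ).1.trans_lt
        (ENNReal.add_lt_top.2 ⟨ENNReal.mul_lt_top (by simp) h, ENNReal.coe_lt_top⟩)
  intro μ hμ
  by_cases hp : ∃ p, IsACDensity μ p
  · obtain ⟨p, hp⟩ := hp
    rw [fisherInfo_eq hp, fisherDist_eq hp hψ]
    have hp1 : ∫⁻ x, ENNReal.ofReal (p x) = 1 := by
      have := measure_univ (μ := μ)
      rw [hp.2.2] at this
      simpa using this
    have heq : ∀ x, (deriv p x) ^ 2 / p x = (deriv p x / p x) ^ 2 * p x := fun x => by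
      rcases eq_or_ne (p x) 0 with h | h
      · simp [h]
      · field_simp
    constructor
    · refine lintegral_ofReal_le_two_mul_add hp.continuous.measurable hp1 fun x => ?_
      rw [heq, Real.coe_toNNReal _ (by positivity)]
      -- Uses `2u² + 2v² - (u - v)² = (u + v)²`.
      nlinarith [hp.1 x, mul_le_mul_of_nonneg_right (hr x) (hp.1 x),
        mul_nonneg (sq_nonneg (deriv p x / p x + deriv ψ x / ψ x)) (hp.1 x)]
    · refine lintegral_ofReal_le_two_mul_add hp.continuous.measurable hp1 fun x => ?_
      rw [heq, Real.coe_toNNReal _ (by positivity)]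
      -- Uses `2(u - v)² + 2v² - u² = (u - 2v)²`.
      nlinarith [hp.1 x, mul_le_mul_of_nonneg_right (hr x) (hp.1 x),
        mul_nonneg (sq_nonneg (deriv p x / p x - 2 * (deriv ψ x / ψ x))) (hp.1 x)]
  · have h1 : fisherInfo μ = ∞ := by
      simp only [fisherInfo, iInf_eq_top]
      exact fun p h => (hp ⟨p, h⟩).elim
    have h2 : fisherDist μ ν = ∞ := by
      simp only [fisherDist, iInf_eq_top]
      exact fun p h => (hp ⟨p, h⟩).elim
    simp [h1, h2]
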